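/- For an integer $r\ge 0$ and real $x>0$ let $\psi_r(x)=\dfrac{d^{\,r+1}}{dx^{\,r+1}}\log\Gamma(x)$ denote the polygamma function of order $r$. Then the function $$\Omega(x)=\frac{2x\psi_1(x)+x^2\psi_2(x)-1}{\bigl(x\psi_1(x)-1\bigr)^2}$$ is strictly decreasing on $(0,\infty)$ and maps $(0,\infty)$ onto the open interval $(-2/3,0)$. Moreover $\lim_{x\to 0^+}\Omega(x)=0$ and $\lim_{x\to\infty}\Omega(x)=-2/3$. -/

import Mathlib

open Set Filter Topology

/-- The polygamma function of order `r` on the positive half-line,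
`ψ_r(x) = d^{r+1} log Γ(x) / dx^{r+1}`. -/
noncomputable def polygamma (r : ℕ) (x : ℝ) : ℝ :=
  iteratedDeriv (r + 1) (fun y : ℝ => Real.log (Real.Gamma y)) x

/-- `Ω(x) = (2 x ψ₁(x) + x² ψ₂(x) - 1) / (x ψ₁(x) - 1)²`. -/
noncomputable def Omega (x : ℝ) : ℝ :=
  (2 * x * polygamma 1 x + x ^ 2 * polygamma 2 x - 1) / (x * polygamma 1 x - 1) ^ 2

/-! Put g(x) = x² ψ₁(x) - x, which is `scaledTrigamma`, and P = x² g'. Then Ω = P / g², and the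
numerator and denominator are each monotone. By ψ₁ = ∑ (x+n)⁻² and its derivatives, P' = 6x² ∑ n²
(x+n)⁻⁴ - 2x, so P decreases once ∑ n² (x+n)⁻⁴ ≤ 1/(3x). Laplace transforms reduce this bound to the
hyperbolic inequality s³ cosh s ≤ sinh³ s (`cosh_mul_pow_three_le_sinh_pow_three`). P is negative
near 0, hence everywhere, so g strictly decreases, from 1 at 0 to 1/2 at ∞. For x < y, P(y) ≤ P(x) <
0 and 0 < g(y) < g(x) give Ω(y) < Ω(x). The limits of Ω are 0/1² and (-1/6)/(1/2)² = -2/3, and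
continuity gives the image. -/

/-- The Hurwitz series `∑ 1 / (x + n) ^ k`. -/
noncomputable def hurwitzSum (k : ℕ) (x : ℝ) : ℝ :=
  ∑' n : ℕ, ((x + n) ^ k)⁻¹

theorem summable_inv_add_nat_pow {k : ℕ} (hk : 2 ≤ k) {x : ℝ} (hx : 0 < x) :
    Summable fun n : ℕ => ((x + n) ^ k)⁻¹ := by
  have h := (Real.summable_one_div_nat_add_rpow x k).2 (by exact_mod_cast hk)
  refine h.congr fun n => ?_
  have : 0 < x + n := by positivity
  rw [Real.rpow_natCast, add_comm, abs_of_pos this, one_div]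

theorem hasSum_hurwitzSum {k : ℕ} (hk : 2 ≤ k) {x : ℝ} (hx : 0 < x) :
    HasSum (fun n : ℕ => ((x + n) ^ k)⁻¹) (hurwitzSum k x) :=
  (summable_inv_add_nat_pow hk hx).hasSum

theorem hasDerivAt_inv_add_pow (k : ℕ) {x a : ℝ} (h : 0 < x + a) :
    HasDerivAt (fun y : ℝ => ((y + a) ^ k)⁻¹) (-k * ((x + a) ^ (k + 1))⁻¹) x := by
  have h1 := (((hasDerivAt_id x).add_const a).pow k).inv (pow_ne_zero k h.ne')
  refine h1.congr_deriv ?_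
  simp only [id]
  rcases k with _ | k
  · simp
  · have := h.ne'
    simp only [Pi.pow_apply, Nat.add_sub_cancel]
    field_simp
    ring

theorem hasDerivAt_hurwitzSum {k : ℕ} (hk : 2 ≤ k) {x : ℝ} (hx : 0 < x) :
    HasDerivAt (hurwitzSum k) (-k * hurwitzSum (k + 1) x) x := by
  have hx2 : 0 < x / 2 := by positivity
  have h := hasDerivAt_tsum_of_isPreconnected (t := Ioi (x / 2))
    (g := fun (n : ℕ) (y : ℝ) => ((y + n) ^ k)⁻¹) (g' := fun (n : ℕ) (y : ℝ) => -k * ((y + n) ^ (k + 1))⁻¹)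
    (u := fun n : ℕ => k * ((x / 2 + n) ^ (k + 1))⁻¹) (y₀ := x) (y := x)
    ((summable_inv_add_nat_pow (by omega) hx2).mul_left _) isOpen_Ioi isPreconnected_Ioi
    (fun n y hy => hasDerivAt_inv_add_pow k (by have : 0 < y := hx2.trans hy; positivity))
    (fun n y hy => by
      have hy' : x / 2 < y := hy
      have : 0 < y := hx2.trans hy'
      rw [norm_mul, norm_neg, Real.norm_of_nonneg (by positivity), Real.norm_of_nonneg (by positivity)]
      gcongr)
    (half_lt_self hx) (summable_inv_add_nat_pow hk hx) (half_lt_self hx)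
  rwa [tsum_mul_left] at h

theorem hurwitzSum_eq_add {k : ℕ} (hk : 2 ≤ k) {x : ℝ} (hx : 0 < x) :
    hurwitzSum k x = (x ^ k)⁻¹ + hurwitzSum k (x + 1) := by
  rw [hurwitzSum, (summable_inv_add_nat_pow hk hx).tsum_eq_zero_add, hurwitzSum]
  simp only [Nat.cast_zero, add_zero, Nat.cast_add, Nat.cast_one]
  refine congrArg _ (tsum_congr fun n => ?_)
  rw [add_assoc, add_comm 1 (n : ℝ)]

/-! ### Termwise differentiation of log Γ -/

/-- The increments of the Gauss approximants of `log Γ`. -/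
noncomputable def logGammaTerm (n : ℕ) (x : ℝ) : ℝ :=
  x * (Real.log (n + 2) - Real.log (n + 1)) + Real.log (n + 2) - Real.log (x + (n + 2 : ℝ))

theorem logGammaSeq_succ_sub (n : ℕ) (x : ℝ) :
    Real.BohrMollerup.logGammaSeq x (n + 2) - Real.BohrMollerup.logGammaSeq x (n + 1) =
      logGammaTerm n x := by
  unfold Real.BohrMollerup.logGammaSeq logGammaTerm
  rw [Finset.sum_range_succ _ (n + 2), Nat.factorial_succ (n + 1), Nat.cast_mul,
    Real.log_mul (by positivity) (by positivity)]
  push_cast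
  rw [show (n : ℝ) + 1 + 1 = n + 2 by ring]
  ring

theorem tendsto_sum_logGammaTerm {x : ℝ} (hx : 0 < x) :
    Tendsto (fun N => ∑ n ∈ Finset.range N, logGammaTerm n x) atTop
      (𝓝 (Real.log (Real.Gamma x) + Real.log x + Real.log (x + 1))) := by
  -- Starting at index 1 avoids log 0; the first approximant is -log x - log (x + 1), whence the two
  -- extra logarithms in the limit.
  have h := (Real.BohrMollerup.tendsto_log_gamma hx).comp (tendsto_add_atTop_nat 1)
  have h2 := h.sub_const (Real.BohrMollerup.logGammaSeq x 1)
  refine (h2.congr fun N => ?_).congr' .rfl |>.trans_eq ?_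
  · simp only [← logGammaSeq_succ_sub, Function.comp]
    rw [Finset.sum_range_sub (fun n => Real.BohrMollerup.logGammaSeq x (n + 1))]
  · congr 1
    simp [Real.BohrMollerup.logGammaSeq, Finset.sum_range_succ]
    ring

theorem hasDerivAt_logGammaTerm (n : ℕ) {x : ℝ} (hx : 0 < x) :
    HasDerivAt (logGammaTerm n)
      (Real.log (n + 2) - Real.log (n + 1) - (x + (n + 2 : ℝ))⁻¹) x := by
  have h0 : x + (n + 2 : ℝ) ≠ 0 := by positivity
  have h1 := ((hasDerivAt_id x).add_const (n + 2 : ℝ)).log h0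
  have h2 := (((hasDerivAt_id x).mul_const (Real.log (n + 2) - Real.log (n + 1))).add_const
    (Real.log (n + 2))).sub h1
  refine h2.congr_deriv ?_
  simp

/-- The logarithmic increment lies between 1/(n+2) and 1/(n+1), which gives a summable bound uniform
on (0, B). -/
theorem abs_deriv_logGammaTerm_le (n : ℕ) {x B : ℝ} (hx : 0 < x) (hB : x < B) :
    |Real.log (n + 2) - Real.log (n + 1) - (x + (n + 2 : ℝ))⁻¹| ≤
      (B + 1) * ((1 + n : ℝ) ^ 2)⁻¹ := by
  have hn : (0 : ℝ) < n + 1 := by positivity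
  have hn2 : (0 : ℝ) < n + 2 := by positivity
  have hB0 : 0 < B := hx.trans hB
  have h1 : Real.log (n + 2) - Real.log (n + 1) ≤ (n + 1 : ℝ)⁻¹ := by
    rw [← Real.log_div hn2.ne' hn.ne']
    refine (Real.log_le_sub_one_of_pos (by positivity)).trans_eq ?_
    field_simp; ring
  have h2 : (n + 2 : ℝ)⁻¹ ≤ Real.log (n + 2) - Real.log (n + 1) := by
    have := Real.log_le_sub_one_of_pos (x := (n + 1) / (n + 2 : ℝ)) (by positivity)
    rw [Real.log_div hn.ne' hn2.ne'] at this
    have e : (n + 1) / (n + 2 : ℝ) - 1 = -(n + 2 : ℝ)⁻¹ := by field_simp; ring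
    linarith
  have h3 : (x + (n + 2 : ℝ))⁻¹ ≤ (n + 2 : ℝ)⁻¹ := by
    exact inv_anti₀ hn2 (by linarith)
  have h4 : (B + (n + 2 : ℝ))⁻¹ ≤ (x + (n + 2 : ℝ))⁻¹ := by
    gcongr
  have h5 : (n + 1 : ℝ)⁻¹ - (B + (n + 2 : ℝ))⁻¹ ≤ (B + 1) * ((1 + n : ℝ) ^ 2)⁻¹ := by
    have e : (n + 1 : ℝ)⁻¹ - (B + (n + 2 : ℝ))⁻¹ = (B + 1) * ((n + 1) * (B + (n + 2 : ℝ)))⁻¹ := by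
      field_simp; ring
    rw [e]
    gcongr
    nlinarith
  rw [abs_le]
  constructor
  · have : 0 ≤ (B + 1) * ((1 + n : ℝ) ^ 2)⁻¹ := by positivity
    linarith
  · linarith

theorem exists_hasDerivAt_log_Gamma :
    ∃ D : ℝ → ℝ, ∀ x, 0 < x →
      HasDerivAt (fun y => Real.log (Real.Gamma y)) (D x) x ∧
        HasDerivAt D (hurwitzSum 2 x) x := by
  let d : ℕ → ℝ → ℝ := fun n x => Real.log (n + 2) - Real.log (n + 1) - (x + (n + 2 : ℝ))⁻¹
  have hu : ∀ B : ℝ, Summable fun n : ℕ => (B + 1) * ((1 + n : ℝ) ^ 2)⁻¹ := fun B =>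
    (summable_inv_add_nat_pow le_rfl one_pos).mul_left _
  have hdb : ∀ B : ℝ, ∀ n, ∀ y ∈ Ioo 0 B, ‖d n y‖ ≤ (B + 1) * ((1 + n : ℝ) ^ 2)⁻¹ :=
    fun B n y hy => abs_deriv_logGammaTerm_le n hy.1 hy.2
  have hds : ∀ x, 0 < x → Summable fun n => d n x := fun x hx =>
    (hu (x + 1)).of_norm_bounded fun n => hdb (x + 1) n x ⟨hx, by linarith⟩
  have hs1 : Summable fun n => logGammaTerm n 1 := by
    refine ((hasSum_iff_tendsto_nat_of_nonneg (fun n => ?_) _).2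
      (tendsto_sum_logGammaTerm one_pos)).summable
    -- At x = 1 the terms are nonnegative because (n+1)(n+3) ≤ (n+2)², so convergence of partial
    -- sums yields summability.
    have h : Real.log ((n + 1 : ℝ) * (n + 3)) ≤ Real.log ((n + 2 : ℝ) * (n + 2)) :=
      Real.log_le_log (by positivity) (by nlinarith)
    rw [Real.log_mul (by positivity) (by positivity),
      Real.log_mul (by positivity) (by positivity)] at h
    rw [logGammaTerm, show (1 : ℝ) + (n + 2) = n + 3 by ring]
    linarith
  have hsum : ∀ x, 0 < x → Summable fun n => logGammaTerm n x := fun x hx =>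
    summable_of_summable_hasDerivAt_of_isPreconnected (t := Ioo 0 (x + 2)) (hu (x + 2)) isOpen_Ioo
      isPreconnected_Ioo (fun n y hy => hasDerivAt_logGammaTerm n hy.1) (hdb (x + 2))
      (y₀ := 1) ⟨one_pos, by linarith⟩ hs1 ⟨hx, by linarith⟩
  have hT : ∀ x, 0 < x → Real.log (Real.Gamma x) =
      ∑' n, logGammaTerm n x - Real.log x - Real.log (x + 1) := fun x hx => by
    rw [tendsto_nhds_unique (hsum x hx).hasSum.tendsto_sum_nat (tendsto_sum_logGammaTerm hx)]
    ring
  refine ⟨fun x => ∑' n, d n x - x⁻¹ - (x + 1)⁻¹, fun x hx => ⟨?_, ?_⟩⟩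
  · have h1 := hasDerivAt_tsum_of_isPreconnected (hu (x + 2)) isOpen_Ioo
      isPreconnected_Ioo (fun n y hy => hasDerivAt_logGammaTerm n hy.1) (hdb (x + 2))
      (y₀ := 1) ⟨one_pos, by linarith⟩ hs1 ⟨hx, by linarith⟩
    have h2 := (h1.sub (Real.hasDerivAt_log hx.ne')).sub
      (((hasDerivAt_id x).add_const 1).log (by simp; positivity))
    refine (h2.congr_of_eventuallyEq ?_).congr_deriv (by simp [d])
    filter_upwards [lt_mem_nhds hx] with y hy
    simpa using hT y hy
  · have hx2 : 0 < x / 2 := by positivity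
    have h1 := hasDerivAt_tsum_of_isPreconnected (t := Ioi (x / 2))
      (g := d) (g' := fun (n : ℕ) (y : ℝ) => ((y + (n + 2 : ℝ)) ^ 2)⁻¹)
      (u := fun n : ℕ => ((x / 2 + n) ^ 2)⁻¹) (y₀ := x) (y := x)
      (summable_inv_add_nat_pow le_rfl hx2) isOpen_Ioi isPreconnected_Ioi
      (fun n y hy => by
        have : x / 2 < y := hy
        have : 0 < y := hx2.trans this
        have h := (hasDerivAt_inv_add_pow 1 (x := y) (a := n + 2) (by positivity)).const_sub
          (Real.log (n + 2) - Real.log (n + 1))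
        simpa [d] using h)
      (fun n y hy => by
        have hy' : x / 2 < y := hy
        have : 0 < y := hx2.trans hy'
        rw [Real.norm_of_nonneg (by positivity)]
        gcongr ?_⁻¹
        gcongr ?_ ^ 2
        linarith)
      (half_lt_self hx) (hds x hx) (half_lt_self hx)
    have h2 := (h1.sub (hasDerivAt_inv_add_pow 1 (x := x) (a := 0) (by simpa))).sub
      (hasDerivAt_inv_add_pow 1 (x := x) (a := 1) (by positivity))
    have h3 : (∑' n : ℕ, ((x + (n + 2 : ℝ)) ^ 2)⁻¹) = hurwitzSum 2 (x + 1 + 1) := by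
      refine tsum_congr fun n => ?_
      rw [show x + ((n : ℝ) + 2) = x + 1 + 1 + n by ring]
    refine (h2.congr_of_eventuallyEq ?_).congr_deriv ?_
    · filter_upwards with y
      simp
    · rw [h3, hurwitzSum_eq_add le_rfl hx, hurwitzSum_eq_add le_rfl (by positivity : 0 < x + 1)]
      simp
      ring

theorem polygamma_eq_hurwitzSum {x : ℝ} (hx : 0 < x) :
    polygamma 1 x = hurwitzSum 2 x ∧ polygamma 2 x = -2 * hurwitzSum 3 x := by
  obtain ⟨D, hD⟩ := exists_hasDerivAt_log_Gamma
  have step : ∀ (k : ℕ) (f g : ℝ → ℝ), (∀ x, 0 < x → iteratedDeriv k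
      (fun y => Real.log (Real.Gamma y)) x = f x) → (∀ x, 0 < x → HasDerivAt f (g x) x) →
      ∀ x, 0 < x → iteratedDeriv (k + 1) (fun y => Real.log (Real.Gamma y)) x = g x := by
    intro k f g hf hg x hx
    rw [iteratedDeriv_succ, ← (hg x hx).deriv]
    refine Filter.EventuallyEq.deriv_eq ?_
    filter_upwards [lt_mem_nhds hx] with y hy using hf y hy
  have h0 := step 0 _ D (fun _ _ => by rw [iteratedDeriv_zero]) fun x hx => (hD x hx).1
  have h1 := step 1 D _ h0 fun x hx => (hD x hx).2
  have h2 := step 2 _ _ h1 fun x hx => hasDerivAt_hurwitzSum le_rfl hx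
  exact ⟨h1 x hx, (h2 x hx).trans (by simp)⟩

/-! ### The bound on ∑ n² (x+n)⁻⁴ -/

/-- With c = (cosh s)^(-1/3), the function sinh s · c - s vanishes at 0 and has derivative (1 - c²)²
(2 + c²) / (3c²) ≥ 0. -/
theorem cosh_mul_pow_three_le_sinh_pow_three {s : ℝ} (hs : 0 ≤ s) :
    s ^ 3 * Real.cosh s ≤ Real.sinh s ^ 3 := by
  let f : ℝ → ℝ := fun s => Real.sinh s * Real.cosh s ^ (-(1 / 3) : ℝ) - s
  have hd : ∀ s, HasDerivAt f (Real.cosh s * Real.cosh s ^ (-(1 / 3) : ℝ) +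
      Real.sinh s * (Real.sinh s * (-(1 / 3)) * Real.cosh s ^ (-(1 / 3) - 1 : ℝ)) - 1) s :=
    fun s => ((Real.hasDerivAt_sinh s).mul ((Real.hasDerivAt_cosh s).rpow_const
      (.inl (Real.cosh_pos s).ne'))).sub (hasDerivAt_id s)
  have hmono : Monotone f := by
    refine monotone_of_deriv_nonneg (fun s => (hd s).differentiableAt) fun s => ?_
    rw [(hd s).deriv, Real.rpow_sub_one (Real.cosh_pos s).ne']
    set c : ℝ := Real.cosh s ^ (-(1 / 3) : ℝ) with hc
    have hC : 0 < Real.cosh s := Real.cosh_pos s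
    have hc0 : 0 < c := Real.rpow_pos_of_pos hC _
    have hc3 : c ^ 3 * Real.cosh s = 1 := by
      rw [hc, ← Real.rpow_natCast, ← Real.rpow_mul hC.le]
      norm_num [Real.rpow_neg_one, hC.ne']
    have hCe : Real.cosh s = (c ^ 3)⁻¹ := eq_inv_of_mul_eq_one_right hc3
    have hS : Real.sinh s * (Real.sinh s * (-(1 / 3)) * (c / Real.cosh s)) =
        -(1 / 3) * (Real.cosh s ^ 2 - 1) * (c / Real.cosh s) := by
      rw [← Real.sinh_sq s]; ring
    rw [hS, hCe]
    have e : (c ^ 3)⁻¹ * c + -(1 / 3) * ((c ^ 3)⁻¹ ^ 2 - 1) * (c / (c ^ 3)⁻¹) - 1 =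
        (1 - c ^ 2) ^ 2 * (2 + c ^ 2) / (3 * c ^ 2) := by
      field_simp
      ring
    rw [e]
    positivity
  have h0 : 0 ≤ f s := by
    have := hmono hs
    simpa [f] using this
  have hC : 0 < Real.cosh s := Real.cosh_pos s
  have h1 : s ^ 3 ≤ (Real.sinh s * Real.cosh s ^ (-(1 / 3) : ℝ)) ^ 3 :=
    pow_le_pow_left₀ hs (sub_nonneg.1 h0) 3
  have h2 : (Real.cosh s ^ (-(1 / 3) : ℝ)) ^ 3 * Real.cosh s = 1 := by
    rw [← Real.rpow_natCast, ← Real.rpow_mul hC.le]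
    norm_num [Real.rpow_neg_one, hC.ne']
  calc s ^ 3 * Real.cosh s
      ≤ (Real.sinh s * Real.cosh s ^ (-(1 / 3) : ℝ)) ^ 3 * Real.cosh s := by gcongr
    _ = Real.sinh s ^ 3 * ((Real.cosh s ^ (-(1 / 3) : ℝ)) ^ 3 * Real.cosh s) := by ring
    _ = Real.sinh s ^ 3 := by rw [h2, mul_one]

theorem pow_three_mul_exp_neg_le {t : ℝ} (ht : 0 ≤ t) :
    t ^ 3 * (Real.exp (-t) * (1 + Real.exp (-t))) ≤ 2 * (1 - Real.exp (-t)) ^ 3 := by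
  have h := cosh_mul_pow_three_le_sinh_pow_three (div_nonneg ht zero_le_two)
  rw [Real.cosh_eq, Real.sinh_eq] at h
  set p := Real.exp (-(t / 2)) with hp
  have hp0 : 0 < p := Real.exp_pos _
  have e1 : Real.exp (t / 2) = p⁻¹ := by rw [hp, Real.exp_neg, inv_inv]
  have e2 : Real.exp (-t) = p ^ 2 := by
    rw [hp, ← Real.exp_nat_mul]; congr 1; push_cast; ring
  rw [e1] at h
  rw [e2]
  -- Here s = t/2 and p = exp (-t/2); the factor 16 p³ clears the negative powers of p.
  have h' := mul_le_mul_of_nonneg_left h (by positivity : 0 ≤ 16 * p ^ 3)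
  have i1 : 16 * p ^ 3 * ((t / 2) ^ 3 * ((p⁻¹ + p) / 2)) = t ^ 3 * (p ^ 2 * (1 + p ^ 2)) := by
    field_simp; ring
  have i2 : 16 * p ^ 3 * ((p⁻¹ - p) / 2) ^ 3 = 2 * (1 - p ^ 2) ^ 3 := by
    field_simp; ring
  rwa [i1, i2] at h'

theorem hasSum_sq_mul_geometric {q : ℝ} (h0 : 0 ≤ q) (h1 : q < 1) :
    HasSum (fun n : ℕ => (n : ℝ) ^ 2 * q ^ n) (q * (1 + q) / (1 - q) ^ 3) := by
  have hq : ‖q‖ < 1 := by rwa [Real.norm_of_nonneg h0]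
  -- Decompose n² = 2·C(n+2, 2) - 3n - 2.
  have a := (hasSum_choose_mul_geometric_of_norm_lt_one 2 hq).mul_left 2
  have b := (hasSum_coe_mul_geometric_of_norm_lt_one hq).mul_left 3
  have c := (hasSum_geometric_of_norm_lt_one hq).mul_left 2
  have hne : 1 - q ≠ 0 := by linarith
  have h := (a.sub b).sub c
  have e : 2 * (1 / (1 - q) ^ (2 + 1)) - 3 * (q / (1 - q) ^ 2) - 2 * (1 - q)⁻¹ =
      q * (1 + q) / (1 - q) ^ 3 := by
    field_simp
    ring
  rw [e] at h
  convert! h using 2 with n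
  rw [Nat.cast_choose_two]
  push_cast
  ring

open MeasureTheory in
theorem integral_pow_mul_exp_neg_mul_Ioi (k : ℕ) {r : ℝ} (hr : 0 < r) :
    IntegrableOn (fun t : ℝ => t ^ k * Real.exp (-(r * t))) (Ioi 0) ∧
      ∫ t in Ioi (0 : ℝ), t ^ k * Real.exp (-(r * t)) = (k.factorial : ℝ) * (r ^ (k + 1))⁻¹ := by
  constructor
  · have h := integrableOn_rpow_mul_exp_neg_mul_rpow (p := 1) (s := k) (b := r)
      (by have : (0 : ℝ) ≤ k := k.cast_nonneg; linarith) one_pos hr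
    simpa using h
  · have h := Real.integral_rpow_mul_exp_neg_mul_Ioi (a := k + 1) (r := r) (by positivity) hr
    simp only [add_sub_cancel_right, Real.rpow_natCast, Real.Gamma_nat_eq_factorial] at h
    rw [h]
    have : ((k : ℝ) + 1) = ((k + 1 : ℕ) : ℝ) := by push_cast; rfl
    rw [this, Real.rpow_natCast, one_div, inv_pow, mul_comm]

open MeasureTheory in
-- Write (x+n)⁻⁴ as ∫ t³ exp (-(x+n)t) / 6 and 1/(3x) as ∫ exp (-xt) / 3, then compare integrands
-- through the closed form of ∑ n² qⁿ at q = exp (-t).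
theorem sum_sq_mul_inv_add_pow_four_le {x : ℝ} (hx : 0 < x) (N : ℕ) :
    ∑ n ∈ Finset.range N, (n : ℝ) ^ 2 * ((x + n) ^ 4)⁻¹ ≤ 1 / (3 * x) := by
  have hpos : ∀ n : ℕ, 0 < x + n := fun n => by positivity
  have hint : ∀ n : ℕ, IntegrableOn
      (fun t : ℝ => (n : ℝ) ^ 2 / 6 * (t ^ 3 * Real.exp (-((x + n) * t)))) (Ioi 0) := fun n =>
    (integral_pow_mul_exp_neg_mul_Ioi 3 (hpos n)).1.const_mul _
  have h0 := integral_pow_mul_exp_neg_mul_Ioi 0 hx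
  have e1 : ∑ n ∈ Finset.range N, (n : ℝ) ^ 2 * ((x + n) ^ 4)⁻¹ = ∫ t in Ioi (0 : ℝ),
      ∑ n ∈ Finset.range N, (n : ℝ) ^ 2 / 6 * (t ^ 3 * Real.exp (-((x + n) * t))) := by
    rw [integral_finsetSum _ fun n _ => hint n]
    refine Finset.sum_congr rfl fun n _ => ?_
    rw [integral_const_mul, (integral_pow_mul_exp_neg_mul_Ioi 3 (hpos n)).2]
    norm_num [Nat.factorial]
    ring
  have e2 : 1 / (3 * x) = ∫ t in Ioi (0 : ℝ), 1 / 3 * (t ^ 0 * Real.exp (-(x * t))) := by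
    rw [integral_const_mul, h0.2]
    norm_num
    ring
  rw [e1, e2]
  refine setIntegral_mono_on (integrable_finsetSum _ fun n _ => hint n) (h0.1.const_mul _)
    measurableSet_Ioi fun t ht => ?_
  have ht : 0 < t := ht
  have hq1 : Real.exp (-t) < 1 := Real.exp_lt_one_iff.2 (by linarith)
  have hq0 := Real.exp_pos (-t)
  have hs := sum_le_hasSum (Finset.range N) (fun n _ => by positivity)
    (hasSum_sq_mul_geometric hq0.le hq1)
  have hd : 0 < 1 - Real.exp (-t) := by linarith
  have key : t ^ 3 * (Real.exp (-t) * (1 + Real.exp (-t)) / (1 - Real.exp (-t)) ^ 3) ≤ 2 := by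
    rw [← mul_div_assoc, div_le_iff₀ (by positivity)]
    exact pow_three_mul_exp_neg_le ht.le
  have e3 : ∑ n ∈ Finset.range N, (n : ℝ) ^ 2 / 6 * (t ^ 3 * Real.exp (-((x + n) * t))) =
      Real.exp (-(x * t)) / 6 *
        (t ^ 3 * ∑ n ∈ Finset.range N, (n : ℝ) ^ 2 * Real.exp (-t) ^ n) := by
    rw [Finset.mul_sum, Finset.mul_sum]
    refine Finset.sum_congr rfl fun n _ => ?_
    rw [show -((x + n) * t) = -(x * t) + n * (-t) by ring, Real.exp_add, Real.exp_nat_mul]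
    ring
  rw [e3]
  calc _ ≤ Real.exp (-(x * t)) / 6 * 2 := by
        gcongr
        exact (mul_le_mul_of_nonneg_left hs (by positivity)).trans key
    _ = _ := by ring

/-- Termwise, the left side is ((x+n) - x)² / (x+n)⁴. -/
theorem hurwitzSum_combination_le {x : ℝ} (hx : 0 < x) :
    hurwitzSum 2 x - 2 * x * hurwitzSum 3 x + x ^ 2 * hurwitzSum 4 x ≤ 1 / (3 * x) := by
  have h := ((hasSum_hurwitzSum le_rfl hx).sub ((hasSum_hurwitzSum (k := 3) (by norm_num) hx).mul_left
    (2 * x))).add ((hasSum_hurwitzSum (k := 4) (by norm_num) hx).mul_left (x ^ 2))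
  refine le_of_tendsto' h.tendsto_sum_nat fun N => ?_
  refine (Finset.sum_le_sum fun n _ => le_of_eq ?_).trans (sum_sq_mul_inv_add_pow_four_le hx N)
  have : x + n ≠ 0 := by positivity
  field_simp
  ring

/-! ### Asymptotic bounds by telescoping -/

theorem le_of_hasSum_of_sub_le {a b : ℕ → ℝ} {s : ℝ} (h : HasSum a s) (hb : Tendsto b atTop (𝓝 0))
    (hab : ∀ n, b n - b (n + 1) ≤ a n) : b 0 ≤ s := by
  have hb' := hb.const_sub (b 0)
  rw [sub_zero] at hb'
  refine le_of_tendsto_of_tendsto' hb' h.tendsto_sum_nat fun N => ?_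
  rw [← Finset.sum_range_sub']
  exact Finset.sum_le_sum fun n _ => hab n

theorem tendsto_inv_pow_add_nat (x : ℝ) {k : ℕ} (hk : k ≠ 0) :
    Tendsto (fun n : ℕ => ((x + n) ^ k)⁻¹) atTop (𝓝 0) :=
  ((tendsto_pow_atTop hk).comp
    (tendsto_atTop_add_const_left _ x tendsto_natCast_atTop_atTop)).inv_tendsto_atTop

/-- This and the next three bounds truncate the asymptotic expansions; the telescoping comparison is
applied to negated series for upper bounds, and each step reduces to an explicit nonnegative
fraction. -/
theorem hurwitzSum_two_le {x : ℝ} (hx : 0 < x) :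
    hurwitzSum 2 x ≤ x⁻¹ + (x ^ 2)⁻¹ / 2 + (x ^ 3)⁻¹ / 6 := by
  have hb := (((tendsto_inv_pow_add_nat x one_ne_zero).add
    ((tendsto_inv_pow_add_nat x two_ne_zero).div_const 2)).add
    ((tendsto_inv_pow_add_nat x three_ne_zero).div_const 6)).neg
  have h := le_of_hasSum_of_sub_le (hasSum_hurwitzSum le_rfl hx).neg (by simpa using hb) fun n => by
    have hy : 0 < x + n := by positivity
    rw [Nat.cast_add, Nat.cast_one, ← add_assoc x (n : ℝ) 1]
    generalize x + (n : ℝ) = y at hy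
    rw [← sub_nonneg]
    refine (by positivity : 0 ≤ (1 / 6) / (y ^ 3 * (y + 1) ^ 3)).trans_eq ?_
    field_simp
    ring
  simp only [Nat.cast_zero, add_zero] at h
  linarith

theorem le_hurwitzSum_two {x : ℝ} (hx : 0 < x) :
    x⁻¹ + (x ^ 2)⁻¹ / 2 + (x ^ 3)⁻¹ / 6 - (x ^ 5)⁻¹ / 30 ≤ hurwitzSum 2 x := by
  have hb := (((tendsto_inv_pow_add_nat x one_ne_zero).add
    ((tendsto_inv_pow_add_nat x two_ne_zero).div_const 2)).add
    ((tendsto_inv_pow_add_nat x three_ne_zero).div_const 6)).sub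
    ((tendsto_inv_pow_add_nat x (k := 5) (by norm_num)).div_const 30)
  have h := le_of_hasSum_of_sub_le (hasSum_hurwitzSum le_rfl hx) (by simpa using hb) fun n => by
    have hy : 0 < x + n := by positivity
    rw [Nat.cast_add, Nat.cast_one, ← add_assoc x (n : ℝ) 1]
    generalize x + (n : ℝ) = y at hy
    rw [← sub_nonneg]
    refine (by positivity : 0 ≤ (1 / 30 + y / 6 + y ^ 2 / 6) / (y ^ 5 * (y + 1) ^ 5)).trans_eq ?_
    field_simp
    ring
  simp only [Nat.cast_zero, add_zero] at h
  linarith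

theorem hurwitzSum_three_le {x : ℝ} (hx : 0 < x) :
    hurwitzSum 3 x ≤ (x ^ 2)⁻¹ / 2 + (x ^ 3)⁻¹ / 2 + (x ^ 4)⁻¹ / 4 := by
  have hb := ((((tendsto_inv_pow_add_nat x two_ne_zero).div_const 2).add
    ((tendsto_inv_pow_add_nat x three_ne_zero).div_const 2)).add
    ((tendsto_inv_pow_add_nat x four_ne_zero).div_const 4)).neg
  have h := le_of_hasSum_of_sub_le (hasSum_hurwitzSum (k := 3) (by norm_num) hx).neg
    (by simpa using hb) fun n => by
    have hy : 0 < x + n := by positivity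
    rw [Nat.cast_add, Nat.cast_one, ← add_assoc x (n : ℝ) 1]
    generalize x + (n : ℝ) = y at hy
    rw [← sub_nonneg]
    refine (by positivity : 0 ≤ (1 / 4 + y / 2) / (y ^ 4 * (y + 1) ^ 4)).trans_eq ?_
    field_simp
    ring
  simp only [Nat.cast_zero, add_zero] at h
  linarith

theorem le_hurwitzSum_three {x : ℝ} (hx : 0 < x) :
    (x ^ 2)⁻¹ / 2 + (x ^ 3)⁻¹ / 2 + (x ^ 4)⁻¹ / 4 - (x ^ 6)⁻¹ / 12 ≤ hurwitzSum 3 x := by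
  have hb := ((((tendsto_inv_pow_add_nat x two_ne_zero).div_const 2).add
    ((tendsto_inv_pow_add_nat x three_ne_zero).div_const 2)).add
    ((tendsto_inv_pow_add_nat x four_ne_zero).div_const 4)).sub
    ((tendsto_inv_pow_add_nat x (k := 6) (by norm_num)).div_const 12)
  have h := le_of_hasSum_of_sub_le (hasSum_hurwitzSum (k := 3) (by norm_num) hx)
    (by simpa using hb) fun n => by
    have hy : 0 < x + n := by positivity
    rw [Nat.cast_add, Nat.cast_one, ← add_assoc x (n : ℝ) 1]
    generalize x + (n : ℝ) = y at hy
    rw [← sub_nonneg]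
    refine (by positivity : 0 ≤ (1 / 12 + y / 2 + y ^ 2 + y ^ 3 * (2 / 3)) /
      (y ^ 6 * (y + 1) ^ 6)).trans_eq ?_
    field_simp
    ring
  simp only [Nat.cast_zero, add_zero] at h
  linarith

theorem hurwitzSum_nonneg (k : ℕ) {x : ℝ} (hx : 0 < x) : 0 ≤ hurwitzSum k x :=
  tsum_nonneg fun n => by positivity

/-! ### Monotonicity and limits of g and x² g' -/

/-- `x ^ 2 * ψ₁ x - x` in terms of the Hurwitz series. -/
noncomputable def scaledTrigamma (x : ℝ) : ℝ :=
  x ^ 2 * hurwitzSum 2 x - x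

/-- The derivative of `scaledTrigamma`. -/
noncomputable def scaledTrigammaDeriv (x : ℝ) : ℝ :=
  2 * x * hurwitzSum 2 x - 2 * x ^ 2 * hurwitzSum 3 x - 1

theorem Omega_eq {x : ℝ} (hx : 0 < x) :
    Omega x = x ^ 2 * scaledTrigammaDeriv x / scaledTrigamma x ^ 2 := by
  have hx' := hx.ne'
  rw [Omega, (polygamma_eq_hurwitzSum hx).1, (polygamma_eq_hurwitzSum hx).2,
    show scaledTrigamma x = x * (x * hurwitzSum 2 x - 1) by rw [scaledTrigamma]; ring, mul_pow,
    mul_div_mul_left _ _ (pow_ne_zero 2 hx'), scaledTrigammaDeriv]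
  ring

theorem hasDerivAt_scaledTrigamma {x : ℝ} (hx : 0 < x) :
    HasDerivAt scaledTrigamma (scaledTrigammaDeriv x) x := by
  have h := (((hasDerivAt_id x).pow 2).mul (hasDerivAt_hurwitzSum le_rfl hx)).sub (hasDerivAt_id x)
  refine h.congr_deriv ?_
  simp [scaledTrigammaDeriv]
  ring

theorem hasDerivAt_sq_mul_scaledTrigammaDeriv {x : ℝ} (hx : 0 < x) :
    HasDerivAt (fun x => x ^ 2 * scaledTrigammaDeriv x)
      (6 * x ^ 2 * (hurwitzSum 2 x - 2 * x * hurwitzSum 3 x + x ^ 2 * hurwitzSum 4 x) - 2 * x) x := by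
  have h2 := hasDerivAt_hurwitzSum le_rfl hx
  have h3 := hasDerivAt_hurwitzSum (k := 3) (by norm_num) hx
  have h := ((hasDerivAt_id x).pow 2).mul
    (((((hasDerivAt_id x).const_mul 2).mul h2).sub
      ((((hasDerivAt_id x).pow 2).const_mul 2).mul h3)).sub_const 1)
  refine h.congr_deriv ?_
  simp
  ring

theorem antitoneOn_sq_mul_scaledTrigammaDeriv :
    AntitoneOn (fun x => x ^ 2 * scaledTrigammaDeriv x) (Ioi 0) := by
  refine antitoneOn_of_deriv_nonpos (convex_Ioi 0)
    (fun x hx => (hasDerivAt_sq_mul_scaledTrigammaDeriv hx).continuousAt.continuousWithinAt)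
    (fun x hx => ?_) fun x hx => ?_
  all_goals rw [interior_Ioi] at hx
  · exact (hasDerivAt_sq_mul_scaledTrigammaDeriv hx).differentiableAt.differentiableWithinAt
  · have hx : 0 < x := hx
    rw [(hasDerivAt_sq_mul_scaledTrigammaDeriv hx).deriv]
    have h := mul_le_mul_of_nonneg_left (hurwitzSum_combination_le hx)
      (by positivity : 0 ≤ 6 * x ^ 2)
    rw [show 6 * x ^ 2 * (1 / (3 * x)) = 2 * x by field_simp; ring] at h
    linarith

/-- Splitting off the n = 0 term removes the singularity at 0. -/
theorem scaledTrigamma_eq_add_one {x : ℝ} (hx : 0 < x) :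
    scaledTrigamma x = 1 - x + x ^ 2 * hurwitzSum 2 (x + 1) := by
  rw [scaledTrigamma, hurwitzSum_eq_add le_rfl hx]
  field_simp
  ring

theorem scaledTrigammaDeriv_eq_add_one {x : ℝ} (hx : 0 < x) :
    scaledTrigammaDeriv x =
      2 * x * hurwitzSum 2 (x + 1) - 2 * x ^ 2 * hurwitzSum 3 (x + 1) - 1 := by
  rw [scaledTrigammaDeriv, hurwitzSum_eq_add le_rfl hx, hurwitzSum_eq_add (by norm_num) hx]
  field_simp
  ring

theorem scaledTrigammaDeriv_neg {x : ℝ} (hx : 0 < x) : scaledTrigammaDeriv x < 0 := by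
  -- For y ≤ 1/5 the only positive term is at most 2 · (1/5) · (5/3) = 2/3 < 1.
  have small : ∀ y, 0 < y → y ≤ 1 / 5 → scaledTrigammaDeriv y < 0 := fun y hy hy5 => by
    rw [scaledTrigammaDeriv_eq_add_one hy]
    have h1 : hurwitzSum 2 (y + 1) ≤ 1 + 1 / 2 + 1 / 6 := by
      refine (hurwitzSum_two_le (by positivity)).trans ?_
      have : ∀ k : ℕ, ((y + 1) ^ k)⁻¹ ≤ 1 := fun k =>
        inv_le_one_of_one_le₀ (one_le_pow₀ (by linarith))
      have e1 := this 1
      rw [pow_one] at e1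
      linarith [this 2, this 3]
    have h2 : 0 ≤ 2 * y ^ 2 * hurwitzSum 3 (y + 1) :=
      mul_nonneg (by positivity) (hurwitzSum_nonneg 3 (by positivity))
    nlinarith [hurwitzSum_nonneg 2 (by positivity : 0 < y + 1)]
  by_contra! hc
  have hm : 0 < min x (1 / 5) := lt_min hx (by norm_num)
  have h := antitoneOn_sq_mul_scaledTrigammaDeriv (mem_Ioi.2 hm) (mem_Ioi.2 hx) (min_le_left _ _)
  have hs := small _ hm (min_le_right _ _)
  have h1 : 0 ≤ x ^ 2 * scaledTrigammaDeriv x := mul_nonneg (by positivity) hc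
  have h2 := mul_neg_of_pos_of_neg (pow_pos hm 2) hs
  exact absurd (h1.trans h) h2.not_ge

theorem strictAntiOn_scaledTrigamma : StrictAntiOn scaledTrigamma (Ioi 0) := by
  refine strictAntiOn_of_deriv_neg (convex_Ioi 0)
    (fun x hx => (hasDerivAt_scaledTrigamma hx).continuousAt.continuousWithinAt) fun x hx => ?_
  rw [interior_Ioi] at hx
  rw [(hasDerivAt_scaledTrigamma hx).deriv]
  exact scaledTrigammaDeriv_neg hx

theorem tendsto_scaledTrigamma_atTop : Tendsto scaledTrigamma atTop (𝓝 (1 / 2)) := by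
  have hi : ∀ k : ℕ, k ≠ 0 → Tendsto (fun x : ℝ => (x ^ k)⁻¹) atTop (𝓝 0) := fun k hk =>
    (tendsto_pow_atTop hk).inv_tendsto_atTop
  have hu := (hi 1 one_ne_zero).div_const 6 |>.const_add (1 / 2)
  have hl := hu.sub ((hi 3 three_ne_zero).div_const 30)
  refine tendsto_of_tendsto_of_tendsto_of_le_of_le' (by simpa using hl) (by simpa using hu) ?_ ?_
  all_goals
    filter_upwards [eventually_gt_atTop 0] with x hx
    rw [scaledTrigamma]
  · refine le_trans (le_of_eq ?_) (sub_le_sub_right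
      (mul_le_mul_of_nonneg_left (le_hurwitzSum_two hx) (sq_nonneg x)) x)
    field_simp
    ring
  · refine (sub_le_sub_right
      (mul_le_mul_of_nonneg_left (hurwitzSum_two_le hx) (sq_nonneg x)) x).trans_eq ?_
    field_simp
    ring

theorem tendsto_sq_mul_scaledTrigammaDeriv_atTop :
    Tendsto (fun x => x ^ 2 * scaledTrigammaDeriv x) atTop (𝓝 (-(1 / 6))) := by
  have hi := (tendsto_pow_atTop (α := ℝ) two_ne_zero).inv_tendsto_atTop
  have hl := (hi.div_const 15).const_sub (-(1 / 6))
  have hu := (hi.div_const 6).const_add (-(1 / 6))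
  refine tendsto_of_tendsto_of_tendsto_of_le_of_le' (by simpa using hl) (by simpa using hu) ?_ ?_
  all_goals
    filter_upwards [eventually_gt_atTop 0] with x hx
    -- In x² g' = 2x³ ∑ (x+n)⁻² - 2x⁴ ∑ (x+n)⁻³ - x², the x² and x terms cancel, leaving 1/3 - 1/2 =
    -- -1/6.
    have h1 := mul_le_mul_of_nonneg_left (le_hurwitzSum_two hx) (by positivity : 0 ≤ 2 * x ^ 3)
    have h2 := mul_le_mul_of_nonneg_left (hurwitzSum_two_le hx) (by positivity : 0 ≤ 2 * x ^ 3)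
    have h3 := mul_le_mul_of_nonneg_left (le_hurwitzSum_three hx) (by positivity : 0 ≤ 2 * x ^ 4)
    have h4 := mul_le_mul_of_nonneg_left (hurwitzSum_three_le hx) (by positivity : 0 ≤ 2 * x ^ 4)
    have e1 : 2 * x ^ 3 * (x⁻¹ + (x ^ 2)⁻¹ / 2 + (x ^ 3)⁻¹ / 6) = 2 * x ^ 2 + x + 1 / 3 := by
      field_simp; ring
    have e2 : 2 * x ^ 3 * (x⁻¹ + (x ^ 2)⁻¹ / 2 + (x ^ 3)⁻¹ / 6 - (x ^ 5)⁻¹ / 30) =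
        2 * x ^ 2 + x + 1 / 3 - (x ^ 2)⁻¹ / 15 := by
      field_simp; ring
    have e3 : 2 * x ^ 4 * ((x ^ 2)⁻¹ / 2 + (x ^ 3)⁻¹ / 2 + (x ^ 4)⁻¹ / 4) =
        x ^ 2 + x + 1 / 2 := by
      field_simp; ring
    have e4 : 2 * x ^ 4 * ((x ^ 2)⁻¹ / 2 + (x ^ 3)⁻¹ / 2 + (x ^ 4)⁻¹ / 4 - (x ^ 6)⁻¹ / 12) =
        x ^ 2 + x + 1 / 2 - (x ^ 2)⁻¹ / 6 := by
      field_simp; ring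
    simp only [scaledTrigammaDeriv]
    linarith

theorem hurwitzSum_add_one_le {k : ℕ} (hk : 2 ≤ k) {x : ℝ} (hx : 0 < x) :
    hurwitzSum k (x + 1) ≤ hurwitzSum k 1 := by
  refine (summable_inv_add_nat_pow hk (by positivity)).tsum_le_tsum (fun n => ?_)
    (summable_inv_add_nat_pow hk one_pos)
  gcongr
  linarith

theorem tendsto_pow_mul_hurwitzSum_add_one {k m : ℕ} (hk : 2 ≤ k) (hm : m ≠ 0) :
    Tendsto (fun x => x ^ m * hurwitzSum k (x + 1)) (𝓝[>] 0) (𝓝 0) := by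
  have h : Tendsto (fun x : ℝ => x ^ m * hurwitzSum k 1) (𝓝[>] 0) (𝓝 0) := by
    have : Continuous fun x : ℝ => x ^ m * hurwitzSum k 1 := by fun_prop
    simpa [hm] using (this.tendsto 0).mono_left (nhdsWithin_le_nhds (s := Ioi 0))
  refine tendsto_of_tendsto_of_tendsto_of_le_of_le' tendsto_const_nhds h ?_ ?_
  all_goals
    filter_upwards [self_mem_nhdsWithin] with x hx
    have hx : 0 < x := hx
  · exact mul_nonneg (by positivity) (hurwitzSum_nonneg k (by positivity))
  · exact mul_le_mul_of_nonneg_left (hurwitzSum_add_one_le hk hx) (by positivity)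

theorem tendsto_id_nhdsGT_zero : Tendsto (fun x : ℝ => x) (𝓝[>] 0) (𝓝 0) :=
  tendsto_id.mono_left nhdsWithin_le_nhds

theorem tendsto_scaledTrigamma_zero : Tendsto scaledTrigamma (𝓝[>] 0) (𝓝 1) := by
  have h := (tendsto_id_nhdsGT_zero.const_sub 1).add
    (tendsto_pow_mul_hurwitzSum_add_one (k := 2) le_rfl two_ne_zero)
  rw [sub_zero, add_zero] at h
  refine h.congr' ?_
  filter_upwards [self_mem_nhdsWithin] with x hx using (scaledTrigamma_eq_add_one hx).symm

theorem tendsto_sq_mul_scaledTrigammaDeriv_zero :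
    Tendsto (fun x => x ^ 2 * scaledTrigammaDeriv x) (𝓝[>] 0) (𝓝 0) := by
  have h := (((tendsto_pow_mul_hurwitzSum_add_one (k := 2) le_rfl three_ne_zero).const_mul 2).sub
    ((tendsto_pow_mul_hurwitzSum_add_one (k := 3) (by norm_num) four_ne_zero).const_mul 2)).sub
    (tendsto_id_nhdsGT_zero.pow 2)
  norm_num at h
  refine h.congr' ?_
  filter_upwards [self_mem_nhdsWithin] with x hx
  rw [scaledTrigammaDeriv_eq_add_one hx]
  ring

theorem half_lt_scaledTrigamma {x : ℝ} (hx : 0 < x) : 1 / 2 < scaledTrigamma x := by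
  -- The limit at infinity alone gives only ≤; passing through x + 1 makes the inequality strict.
  have hx1 : 0 < x + 1 := by positivity
  refine lt_of_le_of_lt ?_ (strictAntiOn_scaledTrigamma (mem_Ioi.2 hx) (mem_Ioi.2 hx1)
    (lt_add_one x))
  refine le_of_tendsto tendsto_scaledTrigamma_atTop ?_
  filter_upwards [eventually_ge_atTop (x + 1)] with y hy
  exact strictAntiOn_scaledTrigamma.antitoneOn (mem_Ioi.2 hx1) (mem_Ioi.2 (hx1.trans_le hy)) hy

/-! ### Monotonicity, limits and image of Ω -/

theorem strictAntiOn_Omega : StrictAntiOn Omega (Ioi 0) := by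
  intro x hx y hy hxy
  have hx' : 0 < x := hx
  have hy' : 0 < y := hy
  rw [Omega_eq hx, Omega_eq hy]
  have hgx := half_lt_scaledTrigamma hx
  have hgy := half_lt_scaledTrigamma hy
  have hg := strictAntiOn_scaledTrigamma hx hy hxy
  have hP := antitoneOn_sq_mul_scaledTrigammaDeriv hx hy hxy.le
  have hPx := mul_neg_of_pos_of_neg (pow_pos hx' 2) (scaledTrigammaDeriv_neg hx)
  have hgy2 : 0 < scaledTrigamma y ^ 2 := by positivity
  have hgg : scaledTrigamma y ^ 2 < scaledTrigamma x ^ 2 :=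
    pow_lt_pow_left₀ hg (by linarith) two_ne_zero
  calc _ ≤ x ^ 2 * scaledTrigammaDeriv x / scaledTrigamma y ^ 2 := by
        gcongr
    _ < _ := by
        rw [div_lt_div_iff₀ hgy2 (hgy2.trans hgg)]
        exact mul_lt_mul_of_neg_left hgg hPx

theorem tendsto_Omega_zero : Tendsto Omega (𝓝[>] (0 : ℝ)) (𝓝 0) := by
  have h := tendsto_sq_mul_scaledTrigammaDeriv_zero.div (tendsto_scaledTrigamma_zero.pow 2)
    (by norm_num)
  rw [zero_div] at h
  refine h.congr' ?_
  filter_upwards [self_mem_nhdsWithin] with x hx using (Omega_eq hx).symm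

theorem tendsto_Omega_atTop : Tendsto Omega atTop (𝓝 (-2 / 3 : ℝ)) := by
  have h := tendsto_sq_mul_scaledTrigammaDeriv_atTop.div (tendsto_scaledTrigamma_atTop.pow 2)
    (by norm_num)
  rw [show -(1 / 6 : ℝ) / (1 / 2) ^ 2 = -2 / 3 by norm_num] at h
  refine h.congr' ?_
  filter_upwards [eventually_gt_atTop 0] with x hx using (Omega_eq hx).symm

theorem continuousOn_Omega : ContinuousOn Omega (Ioi 0) := by
  refine ContinuousOn.congr (f := fun x => x ^ 2 * scaledTrigammaDeriv x / scaledTrigamma x ^ 2)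
    (fun x hx => ?_) fun x hx => Omega_eq hx
  have hg := half_lt_scaledTrigamma hx
  exact ((hasDerivAt_sq_mul_scaledTrigammaDeriv hx).continuousAt.div
    ((hasDerivAt_scaledTrigamma hx).continuousAt.pow 2)
    (pow_ne_zero 2 (by linarith))).continuousWithinAt

theorem neg_two_thirds_lt_Omega {x : ℝ} (hx : 0 < x) : -2 / 3 < Omega x := by
  have hx1 : 0 < x + 1 := by positivity
  refine lt_of_le_of_lt ?_ (strictAntiOn_Omega (mem_Ioi.2 hx) (mem_Ioi.2 hx1) (lt_add_one x))
  refine le_of_tendsto tendsto_Omega_atTop ?_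
  filter_upwards [eventually_ge_atTop (x + 1)] with y hy
  exact strictAntiOn_Omega.antitoneOn (mem_Ioi.2 hx1) (mem_Ioi.2 (hx1.trans_le hy)) hy

theorem Omega_neg {x : ℝ} (hx : 0 < x) : Omega x < 0 := by
  rw [Omega_eq hx]
  have hg := half_lt_scaledTrigamma hx
  exact div_neg_of_neg_of_pos
    (mul_neg_of_pos_of_neg (pow_pos hx 2) (scaledTrigammaDeriv_neg hx)) (by positivity)

theorem mainTheorem5 :
    StrictAntiOn Omega (Ioi (0 : ℝ)) ∧
      Omega '' Ioi (0 : ℝ) = Ioo (-2 / 3 : ℝ) 0 ∧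
      Tendsto Omega (𝓝[>] (0 : ℝ)) (𝓝 0) ∧
      Tendsto Omega atTop (𝓝 (-2 / 3 : ℝ)) := by
  refine ⟨strictAntiOn_Omega, Subset.antisymm ?_ ?_, tendsto_Omega_zero, tendsto_Omega_atTop⟩
  · rintro _ ⟨x, hx, rfl⟩
    exact ⟨neg_two_thirds_lt_Omega hx, Omega_neg hx⟩
  -- Since Ω decreases, the lower endpoint is the limit at infinity and the upper one the limit at
  -- 0.
  · exact isPreconnected_Ioi.intermediate_value_Ioo (le_principal_iff.2 (Ioi_mem_atTop 0))
      (le_principal_iff.2 self_mem_nhdsWithin) continuousOn_Omega tendsto_Omega_atTop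
      tendsto_Omega_zero
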